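/- Let $\mathcal U=\{z\in\mathbb C:|z|\le 1\}$ and let $C(\mathcal U)$ be the space of continuous functions $f:\mathcal U\to\mathbb C$ with the norm $\|f\|=\max_{\mathcal U}|f|$. For pairwise distinct points $z_0,\dots,z_{k-1}\in\mathcal U$, $k\ge1$, write $Z_k=(z_0,\dots,z_{k-1})$ and let $$I_{Z_k}f(z)=\sum_{j=0}^{k-1}f(z_j)\prod_{0\le i<k,\ i\ne j}\frac{z-z_i}{z_j-z_i}$$ be the Lagrange interpolation operator on $C(\mathcal U)$. Its Lebesgue constant is $\mathbb L_{Z_k}=\sup_{f\ne0}\|I_{Z_k}f\|/\|f\|$. For $N\ge1$ let $\mathbb L_N$ denote the Lebesgue constant of the set of all $N$-th roots of unity. Let $E=(e_j)_{j\ge0}$ be a Leja sequence on $\mathcal U$ initiated on the boundary, that is, $e_j\in\mathcal U$ for all $j$, $|e_0|=1$, and for every $k\ge1$ the point $e_k$ is a (not necessarily unique) maximizer of $z\mapsto|z-e_{k-1}|\cdots|z-e_0|$ over $\mathcal U$. (The points $e_j$ are then pairwise distinct.) Let $E_k=(e_0,\dots,e_{k-1})$, $\Delta_0=I_{E_1}$,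 $\Delta_k=I_{E_{k+1}}-I_{E_k}$ for $k\ge1$, and $$\mathbb D_k(E)=\sup_{f\in C(\mathcal U),\ f\neq0}\frac{\|\Delta_kf\|}{\|f\|},\qquad k\ge0.$$ For $k\ge1$ let $\sigma_1(k)$ be the number of ones in the binary expansion of $k$, and let $p(k)$ be the largest integer $p$ such that $2^p$ divides $k$. Then $\mathbb D_0(E)=1$, and for every $k\ge1$ $$\mathbb D_k(E)\le 1+\sqrt{\frac{k}{2^{p(k)}}\left(2^{\sigma_1(k)}-1\right)}\ \,\mathbb L_{2^{p(k)}}.$$ -/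

import Mathlib

noncomputable section

/-- The Lagrange polynomial `l_{j,k}(z) = ∏_{i < k, i ≠ j} (z - z_i) / (z_j - z_i)` of the section
`(z_0, …, z_{k-1})` of a sequence of points of `X ⊆ ℂ`, as a continuous function on `X`. -/
def lagrangeFun {X : Set ℂ} (Z : ℕ → X) (k j : ℕ) : C(X, ℂ) :=
  (Lagrange.basis (Finset.range k) (fun i => (Z i : ℂ)) j).toContinuousMapOn X

/-- The Lagrange interpolation operator `I_{Z_k} f = ∑_{j < k} f(z_j) l_{j,k}` on `C(X)`, which
carries the sup norm. -/
def interpOp {X : Set ℂ} [CompactSpace X] (Z : ℕ → X) (k : ℕ) : C(X, ℂ) →L[ℂ] C(X, ℂ) :=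
  ∑ j ∈ Finset.range k, (ContinuousMap.evalCLM ℂ (Z j)).smulRight (lagrangeFun Z k j)

/-- The Lebesgue constant of the section `(z_0, …, z_{k-1})`: the norm of the interpolation
operator, i.e. the supremum of `‖I_{Z_k} f‖ / ‖f‖` over nonzero `f` in `C(X)`. -/
def lebesgueConst {X : Set ℂ} [CompactSpace X] (Z : ℕ → X) (k : ℕ) : ℝ :=
  ‖interpOp Z k‖

/-- The difference operators `Δ_0 = I_{Z_1}` and `Δ_k = I_{Z_{k+1}} - I_{Z_k}` for `k ≥ 1`. -/
def diffOp {X : Set ℂ} [CompactSpace X] (Z : ℕ → X) : ℕ → (C(X, ℂ) →L[ℂ] C(X, ℂ))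
  | 0 => interpOp Z 1
  | k + 1 => interpOp Z (k + 2) - interpOp Z (k + 1)

/-- `𝔻_k(Z)`: the norm of `Δ_k`, i.e. the supremum of `‖Δ_k f‖ / ‖f‖` over nonzero `f`. -/
def diffNorm {X : Set ℂ} [CompactSpace X] (Z : ℕ → X) (k : ℕ) : ℝ :=
  ‖diffOp Z k‖

/-- Leja sequences on `X`: for every `k ≥ 1`, the point `e_k` maximizes
`z ↦ |z - e_{k-1}| ⋯ |z - e_0|` over `X`. -/
def IsLejaSequence {X : Set ℂ} (E : ℕ → X) : Prop :=
  ∀ k : ℕ, 1 ≤ k →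
    IsMaxOn (fun z : ℂ => ∏ j ∈ Finset.range k, ‖z - (E j : ℂ)‖) X (E k : ℂ)

/-- The points `exp(2πij/N)` of the closed unit disc; for `N ≥ 1` and `j = 0, …, N-1` these are
the `N`-th roots of unity, each listed once. -/
def rootOfUnityPoint (N j : ℕ) : Metric.closedBall (0 : ℂ) 1 :=
  ⟨Complex.exp (((2 * Real.pi * j / N : ℝ) : ℂ) * Complex.I), by
    rw [mem_closedBall_zero_iff, Complex.norm_exp_ofReal_mul_I]⟩

/-- The Lebesgue constant `𝕃_N` of the set of `N`-th roots of unity, on the closed unit disc. -/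
def rootsLebesgueConst (N : ℕ) : ℝ :=
  lebesgueConst (rootOfUnityPoint N) N

/-- The number of ones in the binary expansion of `k` (the sum of its binary digits). -/
def sigmaOne (k : ℕ) : ℕ := (Nat.digits 2 k).sum

end

/-! `Δ_k f` is a multiple of the nodal polynomial of `E_k`, whose modulus peaks at `e_k`; hence `𝔻_k
≤ 1 + ∑ |l_i(e_k)|` (`diffNorm_succ_le`). To bound this sum, note that the points come in antipodal
pairs and that the squares of the even-indexed terms again form a Leja sequence (`odd_eq_neg`,
`isBoundaryLeja_evenSq`). Under this halving `∑ |l_i(e_k)|²` is unchanged for even `k`, and is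
doubled plus one for odd `k`; so it equals `2 ^ σ₁(k) - 1` (`sum_basisNorm_sq`).

For `k = 2 ^ p * m`, blocks of `2 ^ p` points are rotated roots of unity, and each `|l_i(e_k)|`
factors into a value for the `p`-fold squared sequence and a block factor (`basisNorm_two_pow_mul`).
Summing over a block costs at most `𝕃_{2^p}`; Cauchy–Schwarz over the `m` blocks gives the square
root. -/

open Polynomial Lagrange in
/-- Leja sequences on the closed unit disc that start on the unit circle, as complex sequences. -/
structure BoundaryLeja (e : ℕ → ℂ) : Prop where
  norm_le : ∀ j, ‖e j‖ ≤ 1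
  norm_zero : ‖e 0‖ = 1
  isMax : ∀ k z, ‖z‖ ≤ 1 → ‖(nodal (Finset.range k) e).eval z‖ ≤
    ‖(nodal (Finset.range k) e).eval (e k)‖

/-- The squares of the terms of even index. -/
def evenSq (e : ℕ → ℂ) (j : ℕ) : ℂ := e (2 * j) ^ 2

theorem sum_range_mul_eq_sum_sum {M : Type*} [AddCommMonoid M] (f : ℕ → M) (N m : ℕ) :
    ∑ i ∈ Finset.range (N * m), f i =
      ∑ j ∈ Finset.range m, ∑ r ∈ Finset.range N, f (N * j + r) := by
  induction m with
  | zero => simp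
  | succ m ih => rw [Nat.mul_succ, Finset.sum_range_add, ih, Finset.sum_range_succ]

theorem prod_range_mul_eq_prod_prod {M : Type*} [CommMonoid M] (f : ℕ → M) (N m : ℕ) :
    ∏ i ∈ Finset.range (N * m), f i =
      ∏ j ∈ Finset.range m, ∏ r ∈ Finset.range N, f (N * j + r) := by
  induction m with
  | zero => simp
  | succ m ih => rw [Nat.mul_succ, Finset.prod_range_add, ih, Finset.prod_range_succ]

/-! ### Symmetry and squaring of Leja sequences -/

section
open Polynomial Lagrange Finset

theorem nodal_two_mul (e : ℕ → ℂ) (k : ℕ) (h : ∀ j < k, e (2 * j + 1) = -e (2 * j)) :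
    nodal (range (2 * k)) e = (nodal (range k) (evenSq e)).comp (X ^ 2) := by
  rw [nodal, nodal, prod_range_mul_eq_prod_prod, Polynomial.prod_comp]
  refine prod_congr rfl fun j hj => ?_
  rw [prod_range_succ, prod_range_one, h j (mem_range.1 hj)]
  simp only [evenSq, add_zero, C_neg, C_pow, sub_comp, X_comp, pow_comp, C_comp]
  ring

namespace BoundaryLeja
variable {e : ℕ → ℂ} (he : BoundaryLeja e)
include he

theorem eval_nodal_ne_zero (k : ℕ) : (nodal (range k) e).eval (e k) ≠ 0 := by
  intro h
  have hinf : (Metric.closedBall (0 : ℂ) 1).Infinite :=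
    infinite_of_mem_nhds 0 (Metric.closedBall_mem_nhds _ one_pos)
  refine nodal_ne_zero (s := range k) (v := e) (eq_zero_of_infinite_isRoot _ (hinf.mono ?_))
  intro z hz
  have := he.isMax k z (mem_closedBall_zero_iff.1 hz)
  rw [h, _root_.norm_zero] at this
  exact norm_le_zero_iff.1 this

theorem ne_of_lt {i k : ℕ} (h : i < k) : e k ≠ e i := by
  intro hki
  apply he.eval_nodal_ne_zero k
  rw [hki]
  exact eval_nodal_at_node (mem_range.2 h)

theorem injective : Function.Injective e := by
  intro i j hij
  rcases lt_trichotomy i j with h | h | h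
  · exact absurd hij.symm (he.ne_of_lt h)
  · exact h
  · exact absurd hij (he.ne_of_lt h)

/-- Maximum modulus principle: an interior maximizer makes the nodal polynomial constant on the
disc, yet it vanishes at `e 0`. -/
theorem norm_eq_one (k : ℕ) : ‖e k‖ = 1 := by
  rcases Nat.eq_zero_or_pos k with rfl | hk
  · exact he.norm_zero
  by_contra hne
  have hlt : ‖e k‖ < 1 := lt_of_le_of_ne (he.norm_le k) hne
  have hd : DiffContOnCl ℂ (fun z => (nodal (range k) e).eval z) (Metric.ball (0 : ℂ) 1) :=
    (nodal (range k) e).differentiable.diffContOnCl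
  have hcl := Complex.eqOn_closure_of_isPreconnected_of_isMaxOn_norm
    (convex_ball (0 : ℂ) 1).isPreconnected Metric.isOpen_ball hd
    (mem_ball_zero_iff.2 hlt) (fun z hz => he.isMax k z (mem_ball_zero_iff.1 hz).le)
  rw [closure_ball _ one_ne_zero] at hcl
  have h0 := hcl (mem_closedBall_zero_iff.2 (he.norm_le 0))
  apply he.eval_nodal_ne_zero k
  simpa only [Function.const_apply, eval_nodal_at_node (mem_range.2 hk)] using h0.symm

/-- Inductively the nodal polynomial of the first `2 * k` points is even, so `-e (2 * k)` also
maximizes its modulus and lies at distance 2 from `e (2 * k)`. Any maximizer at the next step must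
match that distance. -/
theorem odd_eq_neg (k : ℕ) : e (2 * k + 1) = -e (2 * k) := by
  induction k using Nat.strong_induction_on with
  | _ k ih =>
    have hn := nodal_two_mul e k ih
    have heval : ∀ z, (nodal (range (2 * k + 1)) e).eval z =
        (nodal (range (2 * k)) e).eval z * (z - e (2 * k)) := fun z => by
      rw [eval_nodal, eval_nodal, prod_range_succ]
    have h1 := he.isMax (2 * k + 1) (-e (2 * k)) (by rw [norm_neg]; exact he.norm_le _)
    rw [heval, heval, norm_mul, norm_mul] at h1
    have h2 := he.isMax (2 * k) (e (2 * k + 1)) (he.norm_le _)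
    have h3 : ‖(nodal (range (2 * k)) e).eval (-e (2 * k))‖ =
        ‖(nodal (range (2 * k)) e).eval (e (2 * k))‖ := by
      rw [hn]; simp [eval_comp]
    have h4 : ‖-e (2 * k) - e (2 * k)‖ = 2 := by
      rw [← neg_add', norm_neg, ← two_mul, norm_mul, he.norm_eq_one]; norm_num
    rw [h3, h4] at h1
    have hpos := norm_pos_iff.2 (he.eval_nodal_ne_zero (2 * k))
    have h5 : 2 ≤ ‖e (2 * k + 1) - e (2 * k)‖ := by
      by_contra! hlt
      have := mul_le_mul_of_nonneg_right h2 (norm_nonneg (e (2 * k + 1) - e (2 * k)))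
      nlinarith
    have h6 := parallelogram_law_with_norm ℝ (e (2 * k + 1)) (e (2 * k))
    rw [he.norm_eq_one, he.norm_eq_one] at h6
    have h7 : ‖e (2 * k + 1) + e (2 * k)‖ = 0 := by
      nlinarith [norm_nonneg (e (2 * k + 1) + e (2 * k))]
    exact eq_neg_of_add_eq_zero_left (norm_eq_zero.1 h7)

theorem nodal_even (k : ℕ) :
    nodal (range (2 * k)) e = (nodal (range k) (evenSq e)).comp (X ^ 2) :=
  nodal_two_mul e k fun j _ => he.odd_eq_neg j

theorem isBoundaryLeja_evenSq : BoundaryLeja (evenSq e) where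
  norm_le j := by
    rw [evenSq, norm_pow, he.norm_eq_one, one_pow]
  norm_zero := by
    rw [evenSq, norm_pow, he.norm_eq_one, one_pow]
  isMax k z hz := by
    obtain ⟨y, rfl⟩ := IsAlgClosed.exists_pow_nat_eq z two_pos
    rw [norm_pow] at hz
    have hy : ‖y‖ ≤ 1 := by
      by_contra! h
      exact absurd hz (not_le.2 (one_lt_pow₀ h two_ne_zero))
    simpa [he.nodal_even, eval_comp, evenSq] using he.isMax (2 * k) y hy

end BoundaryLeja
end

/-! ### Squared Lagrange values at the next Leja point -/

section
open Polynomial Lagrange Finset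

/-- The modulus at `e k` of the `i`-th Lagrange basis polynomial of `e 0, …, e (k - 1)`. -/
noncomputable def basisNorm (e : ℕ → ℂ) (k i : ℕ) : ℝ := ‖(Lagrange.basis (range k) e i).eval (e k)‖

theorem norm_eval_basis_of_ne (v : ℕ → ℂ) {k i : ℕ} (hi : i < k) {x : ℂ} (hx : x ≠ v i) :
    ‖(Lagrange.basis (range k) v i).eval x‖ = ‖(nodal (range k) v).eval x‖ *
      (‖(derivative (nodal (range k) v)).eval (v i)‖⁻¹ * ‖x - v i‖⁻¹) := by
  rw [eval_basis_not_at_node (mem_range.2 hi) hx,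
    nodalWeight_eq_eval_derivative_nodal (mem_range.2 hi), norm_mul, norm_mul, norm_inv, norm_inv]

theorem eval_derivative_nodal_ne_zero {v : ℕ → ℂ} (hv : Function.Injective v) {k i : ℕ}
    (hi : i < k) : (derivative (nodal (range k) v)).eval (v i) ≠ 0 := by
  have := nodalWeight_ne_zero (s := range k) hv.injOn (mem_range.2 hi)
  rw [nodalWeight_eq_eval_derivative_nodal (mem_range.2 hi)] at this
  exact fun h => this (by rw [h, inv_zero])

theorem sigmaOne_two_mul (k : ℕ) : sigmaOne (2 * k) = sigmaOne k := by
  rcases Nat.eq_zero_or_pos k with rfl | hk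
  · rfl
  · rw [sigmaOne, sigmaOne, Nat.digits_def' one_lt_two (by omega)]
    simp

theorem sigmaOne_two_mul_add_one (k : ℕ) : sigmaOne (2 * k + 1) = sigmaOne k + 1 := by
  rw [sigmaOne, sigmaOne, Nat.digits_def' one_lt_two (by omega), List.sum_cons,
    Nat.mul_add_mod, show (2 * k + 1) / 2 = k by omega]
  omega

theorem nodal_range_succ (e : ℕ → ℂ) (k : ℕ) :
    nodal (range (k + 1)) e = nodal (range k) e * (X - C (e k)) := by
  rw [nodal, nodal, prod_range_succ]

namespace BoundaryLeja
variable {e : ℕ → ℂ} (he : BoundaryLeja e)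
include he

theorem basisNorm_eq {k i : ℕ} (hi : i < k) :
    basisNorm e k i = ‖(nodal (range k) e).eval (e k)‖ *
      (‖(derivative (nodal (range k) e)).eval (e i)‖⁻¹ * ‖e k - e i‖⁻¹) :=
  norm_eval_basis_of_ne e hi (he.ne_of_lt hi)

theorem eval_nodal_even (k : ℕ) (z : ℂ) :
    (nodal (range (2 * k)) e).eval z = (nodal (range k) (evenSq e)).eval (z ^ 2) := by
  rw [he.nodal_even, eval_comp, eval_pow, eval_X]

theorem eval_derivative_nodal_even (k : ℕ) (z : ℂ) :
    (derivative (nodal (range (2 * k)) e)).eval z =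
      (derivative (nodal (range k) (evenSq e))).eval (z ^ 2) * (2 * z) := by
  rw [he.nodal_even, derivative_comp]
  simp [eval_comp]
  ring

theorem norm_sub_sq_add_norm_add_sq (i j : ℕ) : ‖e i - e j‖ ^ 2 + ‖e i + e j‖ ^ 2 = 4 := by
  have := parallelogram_law_with_norm ℝ (e i) (e j)
  rw [he.norm_eq_one, he.norm_eq_one] at this
  linarith

/-- With `z = e (2 * k)` and `a = e (2 * j)`, the two values are the squared-sequence value times
`|z + a| / 2` and `|z - a| / 2`; the parallelogram law finishes. -/
theorem basisNorm_two_mul_sq_add_sq {k j : ℕ} (hj : j < k) :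
    basisNorm e (2 * k) (2 * j) ^ 2 + basisNorm e (2 * k) (2 * j + 1) ^ 2 =
      basisNorm (evenSq e) k j ^ 2 := by
  rw [he.basisNorm_eq (by omega), he.basisNorm_eq (by omega), he.isBoundaryLeja_evenSq.basisNorm_eq hj,
    he.odd_eq_neg, he.eval_nodal_even, he.eval_derivative_nodal_even,
    he.eval_derivative_nodal_even, neg_sq]
  simp only [norm_mul, norm_neg, he.norm_eq_one, sub_neg_eq_add]
  have hpq : ‖evenSq e k - evenSq e j‖ =
      ‖e (2 * k) - e (2 * j)‖ * ‖e (2 * k) + e (2 * j)‖ := by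
    rw [← norm_mul, evenSq, evenSq]; congr 1; ring
  have hp : ‖e (2 * k) - e (2 * j)‖ ≠ 0 :=
    norm_ne_zero_iff.2 (sub_ne_zero.2 (he.ne_of_lt (by omega)))
  have hq : ‖e (2 * k) + e (2 * j)‖ ≠ 0 := by
    have := he.ne_of_lt (show 2 * j + 1 < 2 * k by omega)
    rw [he.odd_eq_neg] at this
    exact norm_ne_zero_iff.2 fun h => this (eq_neg_of_add_eq_zero_left h)
  have h4 := he.norm_sub_sq_add_norm_add_sq (2 * k) (2 * j)
  have hd := norm_ne_zero_iff.2 (eval_derivative_nodal_ne_zero he.isBoundaryLeja_evenSq.injective hj)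
  rw [hpq]
  change (‖eval (evenSq e k) _‖ * ((‖eval (evenSq e j) _‖ * _)⁻¹ * _)) ^ 2 +
    (‖eval (evenSq e k) _‖ * ((‖eval (evenSq e j) _‖ * _)⁻¹ * _)) ^ 2 = _
  generalize ‖e (2 * k) - e (2 * j)‖ = p at *
  generalize ‖e (2 * k) + e (2 * j)‖ = q at *
  generalize ‖eval (evenSq e j) _‖ = d at *
  generalize ‖eval (evenSq e k) _‖ = a at *
  norm_num
  field_simp
  linear_combination a ^ 2 * h4

theorem sum_basisNorm_two_mul_sq (k : ℕ) :
    ∑ i ∈ range (2 * k), basisNorm e (2 * k) i ^ 2 =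
      ∑ j ∈ range k, basisNorm (evenSq e) k j ^ 2 := by
  rw [sum_range_mul_eq_sum_sum]
  refine sum_congr rfl fun j hj => ?_
  rw [sum_range_succ, sum_range_one, add_zero, he.basisNorm_two_mul_sq_add_sq (mem_range.1 hj)]

/-- The extra node contributes `|e (2 * k + 1) - e (2 * k)| = 2`, cancelling the 2 from the chain
rule, while the distances from `z` to `±e (2 * k)` multiply to the distance between the squares. -/
theorem basisNorm_odd_even {k j : ℕ} (hj : j < k) :
    basisNorm e (2 * k + 1) (2 * j) = basisNorm (evenSq e) k j ∧
    basisNorm e (2 * k + 1) (2 * j + 1) = basisNorm (evenSq e) k j := by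
  have key : ∀ z : ℂ, z ^ 2 = evenSq e j → ‖z‖ = 1 → z ≠ e (2 * k) → z ≠ -e (2 * k) →
      ‖(nodal (range (2 * k + 1)) e).eval (e (2 * k + 1))‖ *
      (‖(derivative (nodal (range (2 * k + 1)) e)).eval z‖⁻¹ * ‖e (2 * k + 1) - z‖⁻¹) =
      basisNorm (evenSq e) k j := by
    intro z hz hz1 h1 h2
    have hg : ‖evenSq e k - evenSq e j‖ = ‖z - e (2 * k)‖ * ‖z + e (2 * k)‖ := by
      rw [← hz, ← norm_mul, ← norm_neg, evenSq]; congr 1; ring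
    have h3 : (nodal (range (2 * k)) e).eval z = 0 := by
      rw [he.eval_nodal_even, hz]; exact eval_nodal_at_node (mem_range.2 hj)
    rw [he.isBoundaryLeja_evenSq.basisNorm_eq hj, nodal_range_succ, hg, derivative_mul]
    simp only [eval_mul, eval_add, eval_sub, eval_X, eval_C, derivative_sub, derivative_X,
      derivative_C, sub_zero, mul_one, h3, add_zero, he.eval_nodal_even,
      he.eval_derivative_nodal_even, hz]
    rw [he.odd_eq_neg, neg_sq, ← neg_add', norm_mul, norm_mul, norm_mul, norm_mul, norm_neg,
      ← neg_add', norm_neg, ← two_mul, norm_mul, he.norm_eq_one, hz1, add_comm (e (2 * k)) z]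
    have hp := norm_ne_zero_iff.2 (sub_ne_zero.2 h1)
    have hq : ‖z + e (2 * k)‖ ≠ 0 :=
      norm_ne_zero_iff.2 fun h => h2 (eq_neg_of_add_eq_zero_left h)
    have hd := norm_ne_zero_iff.2 (eval_derivative_nodal_ne_zero he.isBoundaryLeja_evenSq.injective hj)
    change ‖eval (evenSq e k) _‖ * _ * _ = _
    norm_num
    field_simp
  constructor
  · rw [he.basisNorm_eq (by omega)]
    refine key _ rfl (he.norm_eq_one _) (he.ne_of_lt (by omega)).symm ?_
    rw [← he.odd_eq_neg]
    exact (he.ne_of_lt (by omega)).symm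
  · rw [he.basisNorm_eq (by omega)]
    refine key _ (by rw [he.odd_eq_neg, neg_sq]; rfl) (he.norm_eq_one _)
      (he.ne_of_lt (by omega)).symm ?_
    rw [← he.odd_eq_neg]
    exact (he.ne_of_lt (by omega)).symm

theorem basisNorm_odd_last (k : ℕ) : basisNorm e (2 * k + 1) (2 * k) = 1 := by
  have hk := he.eval_nodal_ne_zero (2 * k)
  rw [he.basisNorm_eq (by omega), nodal_range_succ, derivative_mul]
  simp only [eval_mul, eval_add, eval_sub, eval_X, eval_C, derivative_sub, derivative_X,
      derivative_C, sub_zero, mul_one, sub_self, mul_zero, zero_add]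
  rw [he.odd_eq_neg, he.eval_nodal_even, neg_sq, ← he.eval_nodal_even, ← neg_add', norm_mul,
    norm_neg, ← two_mul, norm_mul, he.norm_eq_one]
  have := norm_ne_zero_iff.2 hk
  norm_num
  field_simp

theorem sum_basisNorm_odd_sq (k : ℕ) :
    ∑ i ∈ range (2 * k + 1), basisNorm e (2 * k + 1) i ^ 2 =
      2 * ∑ j ∈ range k, basisNorm (evenSq e) k j ^ 2 + 1 := by
  rw [sum_range_succ, he.basisNorm_odd_last, one_pow, sum_range_mul_eq_sum_sum, mul_sum]
  congr 1
  refine sum_congr rfl fun j hj => ?_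
  obtain ⟨h1, h2⟩ := he.basisNorm_odd_even (mem_range.1 hj)
  rw [sum_range_succ, sum_range_one, add_zero, h1, h2, two_mul]

end BoundaryLeja

/-- The quadratic Lebesgue function of a Leja section, at the next Leja point. -/
theorem BoundaryLeja.sum_basisNorm_sq {e : ℕ → ℂ} (he : BoundaryLeja e) (k : ℕ) :
    ∑ i ∈ range k, basisNorm e k i ^ 2 = 2 ^ sigmaOne k - 1 := by
  induction k using Nat.strong_induction_on generalizing e with
  | _ k ih =>
    obtain ⟨m, rfl | rfl⟩ := Nat.even_or_odd' k
    · rcases Nat.eq_zero_or_pos m with rfl | hm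
      · simp [sigmaOne]
      · rw [he.sum_basisNorm_two_mul_sq, ih m (by omega) he.isBoundaryLeja_evenSq, sigmaOne_two_mul]
    · rw [he.sum_basisNorm_odd_sq, ih m (by omega) he.isBoundaryLeja_evenSq, sigmaOne_two_mul_add_one, pow_succ]
      ring
end

/-! ### Blocks of length `2 ^ p` -/

section
open Polynomial Lagrange Finset

theorem prod_block_eq {e : ℕ → ℂ} (he : BoundaryLeja e) (p j : ℕ) :
    ∏ r ∈ range (2 ^ p), (X - C (e (2 ^ p * j + r))) =
      X ^ 2 ^ p - C (e (2 ^ p * j) ^ 2 ^ p) := by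
  induction p generalizing e with
  | zero => simp
  | succ p ih =>
    rw [pow_succ', prod_range_mul_eq_prod_prod]
    have h : ∀ r ∈ range (2 ^ p), ∏ s ∈ range 2, (X - C (e (2 * 2 ^ p * j + (2 * r + s)))) =
        (X - C (evenSq e (2 ^ p * j + r))).comp (X ^ 2) := by
      intro r _
      have h1 : 2 * 2 ^ p * j + (2 * r + 1) = 2 * (2 ^ p * j + r) + 1 := by ring
      have h0 : 2 * 2 ^ p * j + (2 * r + 0) = 2 * (2 ^ p * j + r) := by ring
      rw [prod_range_succ, prod_range_one, h1, h0, he.odd_eq_neg]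
      simp only [evenSq, C_neg, C_pow, sub_comp, X_comp, pow_comp, C_comp]
      ring
    rw [prod_congr rfl h, ← Polynomial.prod_comp, ih he.isBoundaryLeja_evenSq]
    simp only [evenSq, sub_comp, X_pow_comp, C_comp, ← pow_mul, ← mul_assoc]

theorem iterate_evenSq_apply (e : ℕ → ℂ) (p j : ℕ) :
    evenSq^[p] e j = e (2 ^ p * j) ^ 2 ^ p := by
  induction p generalizing e with
  | zero => simp
  | succ p ih =>
    rw [Function.iterate_succ_apply, ih, evenSq, ← pow_mul, ← pow_succ', ← mul_assoc, ← pow_succ']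

theorem BoundaryLeja.iterate_evenSq {e : ℕ → ℂ} (he : BoundaryLeja e) (p : ℕ) :
    BoundaryLeja (evenSq^[p] e) := by
  induction p generalizing e with
  | zero => exact he
  | succ p ih => exact ih he.isBoundaryLeja_evenSq

theorem BoundaryLeja.nodal_two_pow_mul {e : ℕ → ℂ} (he : BoundaryLeja e) (p m : ℕ) :
    nodal (range (2 ^ p * m)) e = (nodal (range m) (evenSq^[p] e)).comp (X ^ 2 ^ p) := by
  rw [nodal, nodal, prod_range_mul_eq_prod_prod, Polynomial.prod_comp]
  refine prod_congr rfl fun j _ => ?_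
  rw [prod_block_eq he, iterate_evenSq_apply]
  simp

theorem BoundaryLeja.basisNorm_two_pow_mul {e : ℕ → ℂ} (he : BoundaryLeja e) (p : ℕ) {m j r : ℕ}
    (hj : j < m) (hr : r < 2 ^ p) :
    basisNorm e (2 ^ p * m) (2 ^ p * j + r) = basisNorm (evenSq^[p] e) m j *
      (‖e (2 ^ p * m) ^ 2 ^ p - e (2 ^ p * j) ^ 2 ^ p‖ *
        ((2 : ℝ) ^ p * ‖e (2 ^ p * m) - e (2 ^ p * j + r)‖)⁻¹) := by
  have hlt : 2 ^ p * j + r < 2 ^ p * m := by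
    calc 2 ^ p * j + r < 2 ^ p * (j + 1) := by rw [mul_add_one]; omega
      _ ≤ _ := Nat.mul_le_mul_left _ hj
  have hu : e (2 ^ p * j + r) ^ 2 ^ p = evenSq^[p] e j := by
    have := congrArg (eval (e (2 ^ p * j + r))) (prod_block_eq he p j)
    rw [eval_prod, prod_eq_zero (mem_range.2 hr) (by simp)] at this
    simp only [eval_sub, eval_pow, eval_X, eval_C] at this
    rw [iterate_evenSq_apply]
    exact (sub_eq_zero.1 this.symm)
  have hg := he.iterate_evenSq p
  rw [he.basisNorm_eq hlt, hg.basisNorm_eq hj, he.nodal_two_pow_mul, derivative_comp]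
  simp only [eval_comp, eval_mul, eval_pow, eval_X, derivative_X_pow, hu, eval_C, norm_mul,
    norm_pow, he.norm_eq_one, one_pow, mul_one, ← iterate_evenSq_apply]
  have hd := norm_ne_zero_iff.2 (eval_derivative_nodal_ne_zero hg.injective hj)
  have hz := norm_ne_zero_iff.2 (sub_ne_zero.2 (he.ne_of_lt hlt))
  have hw := norm_ne_zero_iff.2 (sub_ne_zero.2 (hg.ne_of_lt hj))
  push_cast
  simp only [norm_pow, Complex.norm_ofNat]
  field_simp
end

/-! ### Lebesgue functions and roots of unity -/

section
open Polynomial Lagrange Finset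

theorem interpOp_apply {X : Set ℂ} [CompactSpace X] (Z : ℕ → X) (k : ℕ) (f : C(X, ℂ)) (x : X) :
    interpOp Z k f x = ∑ j ∈ range k,
      f (Z j) * (Lagrange.basis (range k) (fun i => (Z i : ℂ)) j).eval (x : ℂ) := by
  simp [interpOp, lagrangeFun, ContinuousMap.evalCLM]

theorem interpOp_apply_eq_eval {X : Set ℂ} [CompactSpace X] (Z : ℕ → X) (k : ℕ) (f : C(X, ℂ))
    (x : X) : interpOp Z k f x =
      (interpolate (range k) (fun i => (Z i : ℂ)) fun i => f (Z i)).eval (x : ℂ) := by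
  rw [interpOp_apply, interpolate_apply, eval_finsetSum]
  simp

/-- The Lebesgue function is bounded by the Lebesgue constant. -/
theorem sum_norm_eval_basis_le_lebesgueConst {X : Set ℂ} [CompactSpace X] (Z : ℕ → X) {k : ℕ}
    (hZ : Set.InjOn Z (range k)) (x : X) :
    ∑ j ∈ range k, ‖(Lagrange.basis (range k) (fun i => (Z i : ℂ)) j).eval (x : ℂ)‖ ≤
      lebesgueConst Z k := by
  classical
  set l : ℕ → ℂ := fun j => (Lagrange.basis (range k) (fun i => (Z i : ℂ)) j).eval (x : ℂ)
  let S : Set X := Z '' (range k)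
  have hfin : S.Finite := (range k).finite_toSet.image Z
  have : Finite S := hfin
  -- The extremal `f` takes the conjugate phase of `l j` at node `j`; Tietze extends it within the
  -- unit ball.
  let φ : ℂ → ℂ := fun w => (starRingEnd ℂ) w / ‖w‖
  have hφ : ∀ w, ‖φ w‖ ≤ 1 := fun w => by
    rw [norm_div, RCLike.norm_conj, Complex.norm_real, norm_norm]
    exact div_self_le_one _
  have hφ' : ∀ w, φ w * w = ‖w‖ := fun w => by
    rcases eq_or_ne w 0 with rfl | hw
    · simp
    · have : (‖w‖ : ℂ) ≠ 0 := by exact_mod_cast norm_ne_zero_iff.2 hw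
      rw [div_mul_eq_mul_div, RCLike.conj_mul, sq]
      exact mul_div_cancel_right₀ _ this
  let g : C(S, ℂ) := ⟨fun s => φ (l (Function.invFunOn Z (range k) s)),
    continuous_of_discreteTopology⟩
  have := Metric.instTietzeExtensionClosedBall ℂ (0 : ℂ) one_pos
  obtain ⟨f, hf1, hf2⟩ := g.exists_forall_mem_restrict_eq (t := Metric.closedBall 0 1)
    hfin.isClosed fun s => mem_closedBall_zero_iff.2 (hφ _)
  have hfnorm : ‖f‖ ≤ 1 := (ContinuousMap.norm_le f zero_le_one).2 fun y =>
    mem_closedBall_zero_iff.1 (hf1 y)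
  have hfZ : ∀ j ∈ range k, f (Z j) = φ (l j) := by
    intro j hj
    have h : f (Z j) = g ⟨Z j, Set.mem_image_of_mem Z hj⟩ := by rw [← hf2]; rfl
    rw [h]
    change φ (l (Function.invFunOn Z (range k) (Z j))) = _
    rw [hZ.leftInvOn_invFunOn hj]
  have hval : interpOp Z k f x = ((∑ j ∈ range k, ‖l j‖ : ℝ) : ℂ) := by
    rw [interpOp_apply, Complex.ofReal_sum]
    exact sum_congr rfl fun j hj => by rw [hfZ j hj, hφ']
  calc ∑ j ∈ range k, ‖l j‖ = ‖interpOp Z k f x‖ := by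
        rw [hval, Complex.norm_real, Real.norm_of_nonneg (sum_nonneg fun _ _ => norm_nonneg _)]
    _ ≤ ‖interpOp Z k f‖ := ContinuousMap.norm_coe_le_norm _ x
    _ ≤ ‖interpOp Z k‖ * ‖f‖ := (interpOp Z k).le_opNorm f
    _ ≤ ‖interpOp Z k‖ * 1 := by gcongr
    _ = lebesgueConst Z k := mul_one _

theorem coe_rootOfUnityPoint (N j : ℕ) :
    (rootOfUnityPoint N j : ℂ) = Complex.exp (2 * Real.pi * Complex.I / N) ^ j := by
  rw [← Complex.exp_nat_mul]
  change Complex.exp _ = _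
  congr 1
  push_cast
  ring

theorem prod_X_sub_C_rootOfUnityPoint {N : ℕ} (hN : 0 < N) (c : ℂ) :
    ∏ j ∈ range N, (X - C ((rootOfUnityPoint N j : ℂ) * c)) = X ^ N - C (c ^ N) := by
  rw [X_pow_sub_C_eq_prod (Complex.isPrimitiveRoot_exp N hN.ne') hN rfl]
  simp only [coe_rootOfUnityPoint]

theorem injOn_rootOfUnityPoint {N : ℕ} (hN : 0 < N) :
    Set.InjOn (rootOfUnityPoint N) (range N) := by
  intro i hi j hj hij
  have := congrArg (Subtype.val) hij
  rw [coe_rootOfUnityPoint, coe_rootOfUnityPoint] at this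
  exact (Complex.isPrimitiveRoot_exp N hN.ne').pow_inj (mem_range.1 hi) (mem_range.1 hj) this

theorem sum_comp_eq_of_prod_X_sub_C_eq {u v : ℕ → ℂ} {N : ℕ} {M : Type*} [AddCommMonoid M]
    (h : ∏ r ∈ range N, (X - C (u r)) = ∏ r ∈ range N, (X - C (v r))) (F : ℂ → M) :
    ∑ r ∈ range N, F (u r) = ∑ r ∈ range N, F (v r) := by
  have key : ∀ w : ℕ → ℂ, (∏ r ∈ range N, (X - C (w r))).roots = (range N).val.map w := fun w => by
    rw [← roots_multiset_prod_X_sub_C ((range N).val.map w), Multiset.map_map]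
    rfl
  have hm : (range N).val.map u = (range N).val.map v := by rw [← key, h, key]
  have := congrArg (fun s => (Multiset.map F s).sum) hm
  simpa only [Multiset.map_map] using! this

/-- The Lebesgue function of the `N`-th roots of `c ^ N` is bounded by that of the `N`-th roots
of unity. -/
theorem sum_norm_inv_le_rootsLebesgueConst {u : ℕ → ℂ} {N : ℕ} (hN : 0 < N) {c z : ℂ}
    (hu : ∏ r ∈ range N, (X - C (u r)) = X ^ N - C (c ^ N)) (hc : ‖c‖ = 1) (hz : ‖z‖ = 1)
    (hzu : z ^ N ≠ c ^ N) :
    ∑ r ∈ range N, ‖z ^ N - c ^ N‖ * ((N : ℝ) * ‖z - u r‖)⁻¹ ≤ rootsLebesgueConst N := by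
  rw [← prod_X_sub_C_rootOfUnityPoint hN] at hu
  rw [sum_comp_eq_of_prod_X_sub_C_eq hu (fun w => ‖z ^ N - c ^ N‖ * ((N : ℝ) * ‖z - w‖)⁻¹)]
  have hc0 : c ≠ 0 := norm_ne_zero_iff.1 (by rw [hc]; exact one_ne_zero)
  -- Rotating by `c⁻¹` carries the nodes to the roots of unity and `z` to `z / c`.
  have hy : ‖z / c‖ ≤ 1 := by rw [norm_div, hc, hz, div_one]
  refine le_trans (le_of_eq ?_) (sum_norm_eval_basis_le_lebesgueConst (rootOfUnityPoint N)
    (injOn_rootOfUnityPoint hN) ⟨z / c, mem_closedBall_zero_iff.2 hy⟩)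
  have hnodal : nodal (range N) (fun i => (rootOfUnityPoint N i : ℂ)) = X ^ N - C 1 := by
    have := prod_X_sub_C_rootOfUnityPoint hN 1
    simpa only [mul_one, one_pow, nodal] using this
  refine sum_congr rfl fun r hr => ?_
  have hr1 : (rootOfUnityPoint N r : ℂ) ^ N = 1 := by
    have := congrArg (eval (rootOfUnityPoint N r : ℂ)) hnodal
    rw [eval_nodal_at_node (v := fun i => (rootOfUnityPoint N i : ℂ)) hr] at this
    simp only [eval_sub, eval_pow, eval_X, eval_C] at this
    exact sub_eq_zero.1 this.symm
  have hrn : ‖(rootOfUnityPoint N r : ℂ)‖ = 1 := Complex.norm_eq_one_of_pow_eq_one hr1 hN.ne'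
  have hne : z / c ≠ rootOfUnityPoint N r := fun h => hzu <| by
    rw [← h, div_pow, div_eq_one_iff_eq (pow_ne_zero _ hc0)] at hr1
    exact hr1
  rw [norm_eval_basis_of_ne _ (mem_range.1 hr) hne, hnodal]
  have h1 : ‖z - rootOfUnityPoint N r * c‖ = ‖z / c - rootOfUnityPoint N r‖ := by
    rw [div_sub' hc0, norm_div, hc, div_one, mul_comm]
  have h2 : ‖z ^ N - c ^ N‖ = ‖(z / c) ^ N - 1‖ := by
    rw [div_pow, div_sub_one (pow_ne_zero _ hc0), norm_div, norm_pow, hc, one_pow, div_one]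
  rw [h1, h2, mul_inv]
  simp [derivative_X_pow, hrn]

end

/-! ### Difference operators and the final bound -/

section
open Polynomial Lagrange Finset

/-- For Leja sequences, the norm of `Δ_{k+1}` is at most one plus the Lebesgue function of the
section, taken at the next Leja point. -/
theorem diffNorm_succ_le {E : ℕ → Metric.closedBall (0 : ℂ) 1}
    (he : BoundaryLeja fun j => (E j : ℂ)) (k : ℕ) :
    diffNorm E (k + 1) ≤
      1 + ∑ i ∈ range (k + 1), basisNorm (fun j => (E j : ℂ)) (k + 1) i := by
  set e : ℕ → ℂ := fun j => (E j : ℂ)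
  have hB : 0 ≤ ∑ i ∈ range (k + 1), basisNorm e (k + 1) i := sum_nonneg fun _ _ => norm_nonneg _
  refine ContinuousLinearMap.opNorm_le_bound _ (by positivity) fun f => ?_
  refine (ContinuousMap.norm_le _ (by positivity)).2 fun x => ?_
  set P := interpolate (range (k + 2)) e fun i => f (E i)
  set Q := interpolate (range (k + 1)) e fun i => f (E i)
  set w := nodal (range (k + 1)) e
  have hw : w.eval (e (k + 1)) ≠ 0 := he.eval_nodal_ne_zero (k + 1)
  set c : ℂ := (f (E (k + 1)) - Q.eval (e (k + 1))) / w.eval (e (k + 1))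
  -- Newton's form: both interpolants agree at the first `k + 1` nodes.
  have hPQ : P - Q = C c * w := by
    refine eq_of_degrees_lt_of_eval_index_eq (range (k + 2)) he.injective.injOn ?_ ?_ ?_
    · refine (degree_sub_le _ _).trans_lt
        (max_lt (degree_interpolate_lt _ he.injective.injOn) ?_)
      refine (degree_interpolate_lt _ he.injective.injOn).trans ?_
      rw [card_range, card_range]
      exact_mod_cast Nat.lt_succ_self _
    · rw [← smul_eq_C_mul]
      refine (degree_smul_le _ _).trans_lt ?_
      rw [degree_nodal, card_range, card_range]
      exact_mod_cast Nat.lt_succ_self _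
    · intro i hi
      rw [eval_sub, eval_interpolate_at_node _ he.injective.injOn hi, eval_mul, eval_C]
      rcases Nat.lt_succ_iff_lt_or_eq.1 (mem_range.1 hi) with h | rfl
      · rw [eval_interpolate_at_node _ he.injective.injOn (mem_range.2 h),
          eval_nodal_at_node (mem_range.2 h), sub_self, mul_zero]
      · rw [div_mul_cancel₀ _ hw]
  have hval : diffOp E (k + 1) f x = c * w.eval (x : ℂ) := by
    have : diffOp E (k + 1) f x = (P - Q).eval (x : ℂ) := by
      rw [eval_sub, ← interpOp_apply_eq_eval, ← interpOp_apply_eq_eval]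
      rfl
    rw [this, hPQ, eval_mul, eval_C]
  have hQ : ‖Q.eval (e (k + 1))‖ ≤ (∑ i ∈ range (k + 1), basisNorm e (k + 1) i) * ‖f‖ := by
    rw [show Q = _ from interpolate_apply .., eval_finsetSum, sum_mul]
    refine norm_sum_le_of_le _ fun i _ => ?_
    rw [eval_mul, eval_C, norm_mul, mul_comm]
    exact mul_le_mul_of_nonneg_left (f.norm_coe_le_norm _) (norm_nonneg _)
  calc ‖diffOp E (k + 1) f x‖ = ‖c‖ * ‖w.eval (x : ℂ)‖ := by rw [hval, norm_mul]
    _ ≤ ‖c‖ * ‖w.eval (e (k + 1))‖ := by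
        gcongr
        exact he.isMax (k + 1) x (mem_closedBall_zero_iff.1 x.2)
    _ = ‖f (E (k + 1)) - Q.eval (e (k + 1))‖ := by rw [← norm_mul, div_mul_cancel₀ _ hw]
    _ ≤ ‖f (E (k + 1))‖ + ‖Q.eval (e (k + 1))‖ := norm_sub_le _ _
    _ ≤ ‖f‖ + (∑ i ∈ range (k + 1), basisNorm e (k + 1) i) * ‖f‖ :=
        add_le_add (f.norm_coe_le_norm _) hQ
    _ = _ := by ring

theorem diffNorm_zero {X : Set ℂ} [CompactSpace X] (Z : ℕ → X) : diffNorm Z 0 = 1 := by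
  have hval : ∀ f x, diffOp Z 0 f x = f (Z 0) := fun f x => by
    change interpOp Z 1 f x = _
    rw [interpOp_apply]
    simp
  apply le_antisymm
  · refine ContinuousLinearMap.opNorm_le_bound _ zero_le_one fun f => ?_
    rw [one_mul]
    refine (ContinuousMap.norm_le _ (norm_nonneg _)).2 fun x => ?_
    rw [hval]
    exact f.norm_coe_le_norm _
  · have : Nonempty X := ⟨Z 0⟩
    have h := (diffOp Z 0).le_opNorm 1
    have h1 : diffOp Z 0 1 = 1 := ContinuousMap.ext fun x => by rw [hval]; rfl
    rw [h1, norm_one, mul_one] at h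
    exact h

theorem sigmaOne_two_pow_mul (p m : ℕ) : sigmaOne (2 ^ p * m) = sigmaOne m := by
  induction p with
  | zero => rw [pow_zero, one_mul]
  | succ p ih => rw [pow_succ', mul_assoc, sigmaOne_two_mul, ih]

theorem BoundaryLeja.sum_basisNorm_two_pow_mul_le {e : ℕ → ℂ} (he : BoundaryLeja e) (p m : ℕ) :
    ∑ i ∈ range (2 ^ p * m), basisNorm e (2 ^ p * m) i ≤
      (∑ j ∈ range m, basisNorm (evenSq^[p] e) m j) * rootsLebesgueConst (2 ^ p) := by
  rw [sum_range_mul_eq_sum_sum, sum_mul]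
  refine sum_le_sum fun j hj => ?_
  rw [sum_congr rfl fun r hr => he.basisNorm_two_pow_mul p (mem_range.1 hj) (mem_range.1 hr),
    ← mul_sum]
  refine mul_le_mul_of_nonneg_left ?_ (norm_nonneg _)
  have hne : e (2 ^ p * m) ^ 2 ^ p ≠ e (2 ^ p * j) ^ 2 ^ p := by
    rw [← iterate_evenSq_apply, ← iterate_evenSq_apply]
    exact (he.iterate_evenSq p).ne_of_lt (mem_range.1 hj)
  simpa only [Nat.cast_pow, Nat.cast_ofNat] using
    sum_norm_inv_le_rootsLebesgueConst (u := fun r => e (2 ^ p * j + r)) (Nat.two_pow_pos p)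
      (prod_block_eq he p j) (he.norm_eq_one _) (he.norm_eq_one _) hne

theorem BoundaryLeja.sum_basisNorm_le {e : ℕ → ℂ} (he : BoundaryLeja e) (k : ℕ) :
    ∑ i ∈ range k, basisNorm e k i ≤ √(k * (2 ^ sigmaOne k - 1)) := by
  refine Real.le_sqrt_of_sq_le ?_
  rw [← he.sum_basisNorm_sq]
  simpa only [card_range] using sq_sum_le_card_mul_sum_sq (s := range k) (f := basisNorm e k)

theorem IsLejaSequence.boundaryLeja {E : ℕ → Metric.closedBall (0 : ℂ) 1} (hE : IsLejaSequence E)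
    (h0 : ‖(E 0 : ℂ)‖ = 1) : BoundaryLeja fun j => (E j : ℂ) where
  norm_le j := mem_closedBall_zero_iff.1 (E j).2
  norm_zero := h0
  isMax k z hz := by
    rcases Nat.eq_zero_or_pos k with rfl | hk
    · simp
    · simpa only [eval_nodal, norm_prod] using! hE k hk (mem_closedBall_zero_iff.2 hz)
end

theorem theorem4p1 (E : ℕ → Metric.closedBall (0 : ℂ) 1) (hE : IsLejaSequence E)
    (h0 : ‖(E 0 : ℂ)‖ = 1) :
    diffNorm E 0 = 1 ∧
    ∀ k : ℕ, 1 ≤ k →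
      diffNorm E k ≤
        1 + √((k : ℝ) / 2 ^ padicValNat 2 k * (2 ^ sigmaOne k - 1)) *
          rootsLebesgueConst (2 ^ padicValNat 2 k) := by
  refine ⟨diffNorm_zero E, fun k hk => ?_⟩
  have he := hE.boundaryLeja h0
  obtain ⟨l, rfl⟩ := Nat.exists_eq_succ_of_ne_zero (Nat.one_le_iff_ne_zero.1 hk)
  refine (diffNorm_succ_le he l).trans (add_le_add le_rfl ?_)
  rw [← Nat.succ_eq_add_one]
  generalize l.succ = k at *
  obtain ⟨m, hm⟩ := pow_padicValNat_dvd (p := 2) (n := k)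
  generalize padicValNat 2 k = p at *
  subst hm
  -- Cauchy–Schwarz is applied only to the `m` blocks, after the block sums are bounded; this yields
  -- `k / 2 ^ p` under the root.
  refine (he.sum_basisNorm_two_pow_mul_le p m).trans
    (mul_le_mul_of_nonneg_right ?_ (norm_nonneg _))
  refine ((he.iterate_evenSq p).sum_basisNorm_le m).trans_eq ?_
  rw [sigmaOne_two_pow_mul, Nat.cast_mul, Nat.cast_pow, Nat.cast_ofNat,
    mul_div_cancel_left₀ _ (by positivity)]
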